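/- **Theorem 5.2.** Let $\mathbb T$ be the unit circle, $m$ the normalized Lebesgue measure on $\mathbb T$, and $P_r(t)=\frac{1-r^2}{|1-rt|^2}$ ($0\le r<1$, $t\in\mathbb T$) the Poisson kernel; convolutions on $\mathbb T$ are taken with respect to $m$. For a finite positive Borel measure $\rho$ on $\mathbb T$ and $n\ge 0$ put $$e_n(\rho)=\operatorname{dist}_{L^2(\rho)}\bigl(1,\mathcal P_n^0\bigr),$$ where $\mathcal P_n^0\subset\mathbb C[z]$ is the set of polynomials of degree at most $n$ vanishing at the origin. For a measurable function $W\colon\mathbb T\to[1,+\infty]$ and $A>0$ put $W_A=\min(W,e^A)$. There is a function $A_0=A_0(\beta,M)>1$ of $\beta,M>0$ such that the following holds. (A) Let $\beta,M>0$, $A\ge A_0(\beta,M)$, let $\rho$ be a finite positive Borel measure on $\mathbb T$, $W\colon\mathbb T\to[1,+\infty]$ measurable, and $0\le C<\infty$. If $$\int_{\mathbb T}W^\beta\,d\rho\le C\qquad\text{and}\qquad (\log W_A)*P_{1-A^{-1}}\le M\log W\ \text{ everywhere on }\mathbb T,$$ then for every integer $n\ge\frac{A^2\beta}{2M}$, $$e_n(\rho)\le\sqrt{2C+\tfrac12\rho(\mathbb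 T)}\;\exp\Bigl(-\frac{\beta}{2M}\int_{\mathbb T}\log W_A\,dm\Bigr).$$ (B) For all $c_0,K,\delta>0$ there is a constant $c>0$, depending only on $c_0,K,\delta$, such that the following holds. Let $\beta,M>0$, $A\ge A_0(\beta,M)$, let $\rho$ be a finite positive Borel measure on $\mathbb T$ and $W\colon\mathbb T\to[1,+\infty]$ measurable. If $d\rho\ge c_0W^{-\beta}\,dm$ on $\mathbb T$ (as measures, with $(+\infty)^{-\beta}=0$), then $$e_n(\rho)\ge c\,\exp\Bigl(-\frac{\beta}{2}\int_{\mathbb T}\log W_A\,dm\Bigr)$$ for every integer $n\ge0$ such that $n\cdot m\{W>e^A\}\le K$ and $m\{W\le e^A\}\ge\delta$. (The last condition is automatic, with $\delta=1-\kappa$, if $n\ge1$ and $n\cdot m\{W>e^A\}\le\kappa<1$; more generally if $n\ge K/(1-\delta)$ with $\delta<1$.) -/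

import Mathlib

open MeasureTheory

noncomputable section

instance : MeasurableSpace Circle := borel Circle

instance : BorelSpace Circle := ⟨rfl⟩

/-- The normalized Lebesgue measure `m = dθ / 2π` on the unit circle. -/
def circleMeasure : Measure Circle :=
  Measure.map Circle.exp
    ((ENNReal.ofReal (2 * Real.pi))⁻¹ • volume.restrict (Set.Ioc (-Real.pi) Real.pi))

instance : IsProbabilityMeasure circleMeasure := by
  have hpi : (0 : ℝ) < 2 * Real.pi := by positivity
  constructor
  rw [circleMeasure, Measure.map_apply Circle.exp.continuous.measurable MeasurableSet.univ]
  have h : Real.pi - -Real.pi = 2 * Real.pi := by ring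
  simp only [Set.preimage_univ, Measure.smul_apply, Measure.restrict_apply_univ,
    Real.volume_Ioc, smul_eq_mul, h]
  exact ENNReal.inv_mul_cancel (by simpa using hpi) ENNReal.ofReal_ne_top

/-- The elements of `L²(ρ)` that are represented by polynomials of degree at most `n` vanishing
at the origin. -/
def polyZero (ρ : Measure Circle) (n : ℕ) : Set (Lp ℂ 2 ρ) :=
  {f | ∃ p : Polynomial ℂ, p.natDegree ≤ n ∧ p.eval 0 = 0 ∧
    (f : Circle → ℂ) =ᵐ[ρ] fun t => p.eval (t : ℂ)}

/-- `e_n(ρ)`: the distance in `L²(ρ)` from the constant function `1` to the polynomials of degree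
at most `n` vanishing at the origin. -/
def polyDist (ρ : Measure Circle) [IsFiniteMeasure ρ] (n : ℕ) : ℝ :=
  Metric.infDist (Lp.const 2 ρ (1 : ℂ)) (polyZero ρ n)

/-- The Poisson kernel `P_r(t) = (1 - r²) / |1 - r t|²` of the unit disk. -/
def diskPoisson (r : ℝ) (t : Circle) : ℝ :=
  (1 - r ^ 2) / ‖1 - (r : ℂ) * (t : ℂ)‖ ^ 2

/-- The convolution on the circle with respect to the normalized Lebesgue measure. -/
def circleConv (f g : Circle → ℝ) (t : Circle) : ℝ :=
  ∫ s, f s * g (t * s⁻¹) ∂circleMeasure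

/-- The truncated weight `W_A = min (W, e^A)`. -/
def truncWeight (W : Circle → ENNReal) (A : ℝ) (t : Circle) : ENNReal :=
  min (W t) (ENNReal.ofReal (Real.exp A))

/-- The real-valued function `log W_A`; the truncated weight is finite. -/
def logTrunc (W : Circle → ENNReal) (A : ℝ) (t : Circle) : ℝ :=
  Real.log (truncWeight W A t).toReal

end

/-! The distance `e_n(ρ)` is the infimum of the `L²(ρ)` norms of polynomials `q` of degree at most
`n` with `q(0) = 1`.

Upper bound. Put `u = κ log W_A` with `κ = β / (2M)`, so that `0 ≤ u ≤ U = κA`, and let `f =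
exp(herglotz u)`. Then `f(0) = exp(∫ u)`, while at radius `r = 1 - 1/A` the modulus of `f` is `exp(u
* P_r) ≤ W^(β/2)` by the convolution hypothesis. Normalizing by `f(0)` produces the required
exponential, so it remains to replace `f(r ·)` by a polynomial. The approximation error carries the
factor `r^(n+1)`, which `n ≥ A²κ` makes at most `exp(-U)`; this offsets the largest possible size
`exp(U)` of `f`. A chord bound for `exp` keeps the remaining error proportional to `u * P_r`
(`exists_polynomial_norm_le`, `exists_polynomial_norm_le_exp_circleConv`).

Lower bound. If `q(0) = 1`, the mean of `log |q|` on the circle is nonnegative, and a set of measure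
`O(1/n)` contributes only a bounded amount beyond its share of that mean, since `|q| ≤ 2^n` times
the Mahler measure. Jensen's inequality on `S = {W ≤ e^A}` then bounds `∫_S |q|² W^(-β)` from below
(`neg_le_setIntegral_log_norm_eval`, `le_setIntegral_norm_eval_sq_mul_exp`). -/

/-! ### Fourier analysis of the Poisson kernel on the circle. -/

theorem integral_circleMeasure {E : Type*} [NormedAddCommGroup E] [NormedSpace ℝ E]
    {f : Circle → E} (hf : AEStronglyMeasurable f circleMeasure) :
    ∫ t, f t ∂circleMeasure =
      (2 * Real.pi)⁻¹ • ∫ θ in (-Real.pi)..Real.pi, f (Circle.exp θ) := by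
  have h2 : (0 : ℝ) ≤ 2 * Real.pi := by positivity
  unfold circleMeasure at hf ⊢
  rw [integral_map Circle.exp.continuous.measurable.aemeasurable hf, integral_smul_measure,
    intervalIntegral.integral_of_le (by linarith [Real.pi_pos])]
  rw [ENNReal.toReal_inv, ENNReal.toReal_ofReal h2]

theorem integral_zpow_circleMeasure (k : ℤ) :
    ∫ t : Circle, (t : ℂ) ^ k ∂circleMeasure = if k = 0 then 1 else 0 := by
  split_ifs with hk
  · simp [hk]
  have hc : Continuous fun t : Circle => (t : ℂ) ^ k :=
    Continuous.zpow₀ (by fun_prop) k fun t => Or.inl t.coe_ne_zero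
  rw [integral_circleMeasure hc.aestronglyMeasurable]
  have hkI : (k : ℂ) * Complex.I ≠ 0 := mul_ne_zero (by exact_mod_cast hk) Complex.I_ne_zero
  have h : ∀ θ : ℝ, ((Circle.exp θ : Circle) : ℂ) ^ k = Complex.exp (k * Complex.I * θ) := by
    intro θ
    rw [Circle.coe_exp, ← Complex.exp_int_mul]
    congr 1
    ring
  simp_rw [h]
  rw [integral_exp_mul_complex hkI]
  have : Complex.exp (k * Complex.I * (Real.pi : ℝ)) =
      Complex.exp (k * Complex.I * ((-Real.pi : ℝ) : ℂ)) := by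
    rw [Complex.exp_eq_exp_iff_exists_int]
    exact ⟨k, by push_cast; ring⟩
  rw [this]
  simp

/-- Makes the finite zero set of a polynomial negligible in the lower bound. -/
instance : NullSingletonClass circleMeasure := by
  constructor
  intro z
  unfold circleMeasure
  rw [Measure.map_apply Circle.exp.continuous.measurable (measurableSet_singleton z)]
  rw [Measure.smul_apply, Measure.restrict_apply
    (Circle.exp.continuous.measurable (measurableSet_singleton z))]
  have hs : (Circle.exp ⁻¹' {z} ∩ Set.Ioc (-Real.pi) Real.pi) ⊆ {Complex.arg z} := by
    rintro x ⟨hx, h1, h2⟩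
    have hx' : Circle.exp x = z := hx
    rw [Set.mem_singleton_iff, ← hx', Circle.arg_exp h1 h2]
  rw [measure_mono_null hs (by simp), smul_zero]

theorem Circle.one_sub_mul_ne_zero {r : ℝ} (h0 : 0 ≤ r) (h1 : r < 1) (w : Circle) :
    1 - (r : ℂ) * w ≠ 0 := by
  intro h
  have : ‖(r : ℂ) * w‖ = 1 := by rw [← sub_eq_zero.mp h]; simp
  rw [norm_mul, Circle.norm_coe, Complex.norm_real, Real.norm_of_nonneg h0] at this
  linarith

theorem continuous_diskPoisson {r : ℝ} (h0 : 0 ≤ r) (h1 : r < 1) :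
    Continuous (diskPoisson r) := by
  unfold diskPoisson
  refine Continuous.div continuous_const (by fun_prop) fun w => ?_
  exact pow_ne_zero _ (norm_ne_zero_iff.mpr (Circle.one_sub_mul_ne_zero h0 h1 w))

theorem diskPoisson_nonneg {r : ℝ} (h0 : 0 ≤ r) (h1 : r < 1) (w : Circle) :
    0 ≤ diskPoisson r w :=
  div_nonneg (by nlinarith) (by positivity)

theorem hasSum_diskPoisson {r : ℝ} (h0 : 0 ≤ r) (h1 : r < 1) (w : Circle) :
    HasSum (fun j : ℤ => (r : ℂ) ^ j.natAbs * (w : ℂ) ^ j) (diskPoisson r w : ℂ) := by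
  have hn : ‖(r : ℂ) * w‖ < 1 := by simpa [abs_of_nonneg h0, Circle.norm_coe] using h1
  have hn' : ‖(r : ℂ) * (w⁻¹ : Circle)‖ < 1 := by simpa [abs_of_nonneg h0, Circle.norm_coe] using h1
  have a1 := hasSum_geometric_of_norm_lt_one hn
  have a2 := (hasSum_geometric_of_norm_lt_one hn').mul_left ((r : ℂ) * (w⁻¹ : Circle))
  have e : ∀ n : ℕ, (r : ℂ) ^ (-((n : ℤ) + 1)).natAbs * (w : ℂ) ^ (-((n : ℤ) + 1)) =
      (r : ℂ) * (w⁻¹ : Circle) * ((r : ℂ) * (w⁻¹ : Circle)) ^ n := by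
    intro n
    have : (-((n : ℤ) + 1)).natAbs = n + 1 := by omega
    rw [this, zpow_neg, ← pow_succ', mul_pow, Circle.coe_inv, inv_pow]
    norm_cast
  have key := HasSum.of_nat_of_neg_add_one
    (f := fun j : ℤ => (r : ℂ) ^ j.natAbs * (w : ℂ) ^ j) (m := (1 - (r : ℂ) * w)⁻¹)
    (m' := (r : ℂ) * (w⁻¹ : Circle) * (1 - (r : ℂ) * (w⁻¹ : Circle))⁻¹)
    (by simpa [mul_pow] using a1) (by simpa only [e] using a2)
  convert key using 1
  have e1 := Circle.one_sub_mul_ne_zero h0 h1 w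
  have e2 := Circle.one_sub_mul_ne_zero h0 h1 w⁻¹
  have hc : (starRingEnd ℂ) (1 - (r : ℂ) * w) = 1 - (r : ℂ) * (w⁻¹ : Circle) := by
    rw [map_sub, map_one, map_mul, Complex.conj_ofReal, Circle.coe_inv_eq_conj]
  have hsq : ((‖1 - (r : ℂ) * w‖ ^ 2 : ℝ) : ℂ) =
      (1 - (r : ℂ) * w) * (1 - (r : ℂ) * (w⁻¹ : Circle)) := by
    rw [← hc, Complex.mul_conj, Complex.normSq_eq_norm_sq]
  unfold diskPoisson
  rw [Complex.ofReal_div, hsq]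
  have hw : (w : ℂ) * (w⁻¹ : Circle) = 1 := by
    rw [← Circle.coe_mul]; simp
  field_simp
  push_cast
  field_simp [w.coe_ne_zero]
  ring

/-- Multiplying the kernel by the character of frequency `m` translates its Fourier multiplier from
`r^|k|` to `r^|k - m|`. The cases needed later are `m = n + 1`, where the multiplier cancels the
tail of a Taylor series, and `m = 0`. -/
theorem integral_zpow_mul_diskPoisson {r : ℝ} (h0 : 0 ≤ r) (h1 : r < 1) (z : Circle) (k m : ℤ) :
    ∫ s : Circle, (s : ℂ) ^ k * ((z * s⁻¹ : Circle) : ℂ) ^ m *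
      (diskPoisson r (z * s⁻¹) : ℂ) ∂circleMeasure = (r : ℂ) ^ (k - m).natAbs * (z : ℂ) ^ k := by
  have hsum : ∀ s : Circle, HasSum (fun j : ℤ => (s : ℂ) ^ k * ((z * s⁻¹ : Circle) : ℂ) ^ m *
      ((r : ℂ) ^ j.natAbs * ((z * s⁻¹ : Circle) : ℂ) ^ j))
      ((s : ℂ) ^ k * ((z * s⁻¹ : Circle) : ℂ) ^ m * (diskPoisson r (z * s⁻¹) : ℂ)) :=
    fun s => (hasSum_diskPoisson h0 h1 _).mul_left _
  have hs : ∀ (s : Circle) (j : ℤ), (s : ℂ) ^ k * ((z * s⁻¹ : Circle) : ℂ) ^ m *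
      ((r : ℂ) ^ j.natAbs * ((z * s⁻¹ : Circle) : ℂ) ^ j) =
      ((r : ℂ) ^ j.natAbs * (z : ℂ) ^ (m + j)) * (s : ℂ) ^ (k - m - j) := by
    intro s j
    have hs0 := s.coe_ne_zero
    have hz0 := z.coe_ne_zero
    rw [Circle.coe_mul, Circle.coe_inv, mul_zpow, mul_zpow, zpow_add₀ hz0, zpow_sub₀ hs0,
      zpow_sub₀ hs0, inv_zpow, inv_zpow]
    field_simp
  have hc : ∀ l : ℤ, Continuous fun s : Circle => (s : ℂ) ^ l := fun l =>
    Continuous.zpow₀ (by fun_prop) l fun t => Or.inl t.coe_ne_zero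
  have hi : ∀ j : ℤ, Integrable (fun s : Circle => (s : ℂ) ^ k * ((z * s⁻¹ : Circle) : ℂ) ^ m *
      ((r : ℂ) ^ j.natAbs * ((z * s⁻¹ : Circle) : ℂ) ^ j)) circleMeasure := by
    intro j
    simp_rw [hs]
    exact (((hc _).const_mul _).integrable_of_hasCompactSupport
      (HasCompactSupport.of_compactSpace _))
  have hgeo : Summable fun j : ℤ => r ^ j.natAbs := by
    have := (hasSum_diskPoisson h0 h1 1).summable.norm
    simpa [abs_of_nonneg h0, Circle.norm_coe] using this
  have H := hasSum_integral_of_summable_integral_norm hi (by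
    simpa [abs_of_nonneg h0, Circle.norm_coe] using hgeo)
  have ht := fun s => (hsum s).tsum_eq
  rw [funext ht] at H
  refine H.unique ?_
  have hj : ∀ j : ℤ, ∫ s : Circle, (s : ℂ) ^ k * ((z * s⁻¹ : Circle) : ℂ) ^ m *
      ((r : ℂ) ^ j.natAbs * ((z * s⁻¹ : Circle) : ℂ) ^ j) ∂circleMeasure =
      if j = k - m then (r : ℂ) ^ (k - m).natAbs * (z : ℂ) ^ k else 0 := ?_
  · rw [funext hj]
    exact hasSum_ite_eq (k - m) _
  intro j
  rw [integral_congr_ae (Filter.Eventually.of_forall fun s => hs s j), integral_const_mul,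
    integral_zpow_circleMeasure]
  by_cases hj : j = k - m
  · subst hj; simp
  · rw [if_neg hj, if_neg (by omega), mul_zero]

theorem hasSum_integral_mul_diskPoisson {r : ℝ} (h0 : 0 ≤ r) (h1 : r < 1) (z : Circle) (m : ℤ)
    {c : ℕ → ℂ} (hc : Summable fun k => ‖c k‖) :
    HasSum (fun k : ℕ => c k * ((r : ℂ) ^ ((k : ℤ) - m).natAbs * (z : ℂ) ^ k))
      (∫ s : Circle, (∑' k, c k * (s : ℂ) ^ k) * ((z * s⁻¹ : Circle) : ℂ) ^ m *
        (diskPoisson r (z * s⁻¹) : ℂ) ∂circleMeasure) := by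
  have hP := continuous_diskPoisson h0 h1
  have hcz : ∀ l : ℤ, Continuous fun s : Circle => ((z * s⁻¹ : Circle) : ℂ) ^ l := fun l =>
    Continuous.zpow₀ (by fun_prop) l fun t => Or.inl (Circle.coe_ne_zero _)
  have hPz : Continuous fun s : Circle => diskPoisson r (z * s⁻¹) := hP.comp (by fun_prop)
  have hi : ∀ k : ℕ, Integrable (fun s : Circle => c k * ((s : ℂ) ^ (k : ℤ) *
      ((z * s⁻¹ : Circle) : ℂ) ^ m * (diskPoisson r (z * s⁻¹) : ℂ))) circleMeasure := by
    intro k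
    refine Continuous.integrable_of_hasCompactSupport ?_ (HasCompactSupport.of_compactSpace _)
    simp only [zpow_natCast]
    have := hcz m
    fun_prop
  have H := hasSum_integral_of_summable_integral_norm hi (by
    have : ∀ k : ℕ, ∫ s : Circle, ‖c k * ((s : ℂ) ^ (k : ℤ) *
      ((z * s⁻¹ : Circle) : ℂ) ^ m * (diskPoisson r (z * s⁻¹) : ℂ))‖ ∂circleMeasure =
      ‖c k‖ * ∫ s : Circle, |diskPoisson r (z * s⁻¹)| ∂circleMeasure := by
        intro k
        rw [← integral_const_mul]
        congr 1 with s
        simp [Circle.norm_coe]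
    simp_rw [this]
    exact hc.mul_right _)
  simp_rw [integral_const_mul, integral_zpow_mul_diskPoisson h0 h1] at H
  simp only [zpow_natCast] at H
  have e : ∀ s : Circle, (∑' k, c k * (s : ℂ) ^ k) * ((z * s⁻¹ : Circle) : ℂ) ^ m *
      (diskPoisson r (z * s⁻¹) : ℂ) = ∑' k, c k * ((s : ℂ) ^ k *
      ((z * s⁻¹ : Circle) : ℂ) ^ m * (diskPoisson r (z * s⁻¹) : ℂ)) := by
    intro s
    rw [mul_assoc, ← tsum_mul_right]
    exact tsum_congr fun k => by ring
  rw [integral_congr_ae (Filter.Eventually.of_forall e)]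
  exact H

theorem integral_diskPoisson {r : ℝ} (h0 : 0 ≤ r) (h1 : r < 1) (z : Circle) :
    ∫ s : Circle, diskPoisson r (z * s⁻¹) ∂circleMeasure = 1 := by
  have h := integral_zpow_mul_diskPoisson h0 h1 z 0 0
  simp only [zpow_zero, one_mul, sub_self, Int.natAbs_zero, pow_zero] at h
  rw [integral_complex_ofReal] at h
  exact_mod_cast h

/-! ### The Herglotz transform. -/

/-- The Taylor coefficients of the Herglotz transform of `u`. -/
noncomputable def herglotzCoeff (u : Circle → ℝ) (k : ℕ) : ℂ :=
  (if k = 0 then 1 else 2) * ∫ s : Circle, (u s : ℂ) * ((s⁻¹ : Circle) : ℂ) ^ k ∂circleMeasure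

/-- The Herglotz transform of `u`: the analytic function in the unit disk whose real part is the
Poisson integral of `u` and which is real at the origin. -/
noncomputable def herglotz (u : Circle → ℝ) (z : ℂ) : ℂ := ∑' k, herglotzCoeff u k * z ^ k

theorem integrable_of_bounded_circle {E : Type*} [NormedAddCommGroup E] {f : Circle → E}
    (hf : AEStronglyMeasurable f circleMeasure) (C : ℝ) (h : ∀ t, ‖f t‖ ≤ C) :
    Integrable f circleMeasure :=
  Integrable.of_bound hf C (Filter.Eventually.of_forall h)

theorem integrable_mul_diskPoisson {u : Circle → ℝ} (hu : Measurable u) {U : ℝ}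
    (h0 : ∀ t, 0 ≤ u t) (hU : ∀ t, u t ≤ U) {r : ℝ} (hr0 : 0 ≤ r) (hr1 : r < 1) (z : Circle) :
    Integrable (fun s => u s * diskPoisson r (z * s⁻¹)) circleMeasure := by
  have hP : Continuous fun s : Circle => diskPoisson r (z * s⁻¹) :=
    (continuous_diskPoisson hr0 hr1).comp (by fun_prop)
  refine Integrable.bdd_mul (c := U)
    (hP.integrable_of_hasCompactSupport (HasCompactSupport.of_compactSpace _))
    hu.aestronglyMeasurable (Filter.Eventually.of_forall fun t => ?_)
  rw [Real.norm_of_nonneg (h0 t)]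
  exact hU t

theorem circleConv_diskPoisson_nonneg {u : Circle → ℝ} (h0 : ∀ t, 0 ≤ u t)
    {r : ℝ} (hr0 : 0 ≤ r) (hr1 : r < 1) (z : Circle) : 0 ≤ circleConv u (diskPoisson r) z :=
  integral_nonneg fun s => mul_nonneg (h0 s) (diskPoisson_nonneg hr0 hr1 _)

theorem circleConv_diskPoisson_le {u : Circle → ℝ} (hu : Measurable u) {U : ℝ}
    (h0 : ∀ t, 0 ≤ u t) (hU : ∀ t, u t ≤ U) {r : ℝ} (hr0 : 0 ≤ r) (hr1 : r < 1) (z : Circle) :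
    circleConv u (diskPoisson r) z ≤ U := by
  have hP : Continuous fun s : Circle => diskPoisson r (z * s⁻¹) :=
    (continuous_diskPoisson hr0 hr1).comp (by fun_prop)
  calc circleConv u (diskPoisson r) z
      ≤ ∫ s, U * diskPoisson r (z * s⁻¹) ∂circleMeasure := by
        refine integral_mono (integrable_mul_diskPoisson hu h0 hU hr0 hr1 z)
          ((hP.integrable_of_hasCompactSupport
            (HasCompactSupport.of_compactSpace _)).const_mul U) fun s => ?_
        exact mul_le_mul_of_nonneg_right (hU s) (diskPoisson_nonneg hr0 hr1 _)
    _ = U := by rw [integral_const_mul, integral_diskPoisson hr0 hr1, mul_one]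

theorem norm_herglotzCoeff_le {u : Circle → ℝ} {U : ℝ}
    (h0 : ∀ t, 0 ≤ u t) (hU : ∀ t, u t ≤ U) (k : ℕ) : ‖herglotzCoeff u k‖ ≤ 2 * U := by
  have h : ‖∫ s : Circle, (u s : ℂ) * ((s⁻¹ : Circle) : ℂ) ^ k ∂circleMeasure‖ ≤ U := by
    refine (norm_integral_le_of_norm_le_const (C := U)
      (Filter.Eventually.of_forall fun s => ?_)).trans (by simp)
    rw [norm_mul, norm_pow, Circle.norm_coe, one_pow, mul_one, Complex.norm_real,
      Real.norm_of_nonneg (h0 s)]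
    exact hU s
  have hd : ‖(if k = 0 then 1 else 2 : ℂ)‖ ≤ 2 := by split_ifs <;> simp
  rw [herglotzCoeff, norm_mul]
  exact mul_le_mul hd h (norm_nonneg _) (by norm_num)

theorem hasSum_herglotz {u : Circle → ℝ} {U : ℝ}
    (h0 : ∀ t, 0 ≤ u t) (hU : ∀ t, u t ≤ U) {z : ℂ} (hz : ‖z‖ < 1) :
    HasSum (fun k => herglotzCoeff u k * z ^ k) (herglotz u z) := by
  refine Summable.hasSum (Summable.of_norm_bounded
    (g := fun k => 2 * U * ‖z‖ ^ k) ((summable_geometric_of_lt_one (norm_nonneg _) hz).mul_left _)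
    fun k => ?_)
  rw [norm_mul, norm_pow]
  exact mul_le_mul_of_nonneg_right (norm_herglotzCoeff_le h0 hU k) (by positivity)

theorem differentiableOn_herglotz {u : Circle → ℝ} {U : ℝ}
    (h0 : ∀ t, 0 ≤ u t) (hU : ∀ t, u t ≤ U) :
    DifferentiableOn ℂ (herglotz u) (Metric.ball 0 1) := by
  intro z hz
  obtain ⟨R, hzR, hR1⟩ := exists_between (mem_ball_zero_iff.mp hz)
  have hR0 : 0 ≤ R := (norm_nonneg z).trans hzR.le
  have hd : DifferentiableOn ℂ (herglotz u) (Metric.ball 0 R) := by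
    refine Complex.differentiableOn_tsum_of_summable_norm (u := fun k => 2 * U * R ^ k)
      ((summable_geometric_of_lt_one hR0 hR1).mul_left _) (fun k => by fun_prop)
      Metric.isOpen_ball fun k w hw => ?_
    rw [norm_mul, norm_pow]
    exact mul_le_mul (norm_herglotzCoeff_le h0 hU k)
      (pow_le_pow_left₀ (norm_nonneg _) (mem_ball_zero_iff.mp hw).le _) (by positivity)
      ((norm_nonneg _).trans (norm_herglotzCoeff_le h0 hU k))
  exact (hd.differentiableAt (Metric.isOpen_ball.mem_nhds
    (mem_ball_zero_iff.mpr hzR))).differentiableWithinAt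

theorem herglotz_zero {u : Circle → ℝ} : herglotz u 0 = (∫ s, u s ∂circleMeasure : ℝ) := by
  rw [herglotz, tsum_eq_single 0 (fun k hk => by simp [hk])]
  simp only [herglotzCoeff, pow_zero, mul_one, if_true, one_mul]
  exact integral_complex_ofReal

/-- The sum is the Herglotz kernel `(1 + x) / (1 - x)`, written as twice a geometric series minus
its doubled constant term. -/
theorem hasSum_herglotzKernel {x : ℂ} (hx : ‖x‖ < 1) :
    HasSum (fun k : ℕ => (if k = 0 then 1 else 2) * x ^ k) (2 * (1 - x)⁻¹ - 1) := by
  have h := ((hasSum_geometric_of_norm_lt_one hx).mul_left 2).sub (hasSum_ite_eq 0 (1 : ℂ))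
  refine h.congr_fun fun k => ?_
  by_cases hk : k = 0
  · subst hk; norm_num
  · simp [hk]

theorem re_herglotzKernel {r : ℝ} (h0 : 0 ≤ r) (h1 : r < 1) (w : Circle) :
    (2 * (1 - (r : ℂ) * w)⁻¹ - 1).re = diskPoisson r w := by
  have e := Circle.one_sub_mul_ne_zero h0 h1 w
  have hw : Complex.normSq w = 1 := Circle.normSq_coe w
  have hn : Complex.normSq (1 - (r : ℂ) * w) ≠ 0 := by rwa [Ne, Complex.normSq_eq_zero]
  rw [diskPoisson, ← Complex.normSq_eq_norm_sq, eq_div_iff hn]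
  simp only [Complex.sub_re, Complex.mul_re, Complex.inv_re, Complex.one_re, Complex.re_ofNat,
    Complex.im_ofNat, zero_mul, sub_zero]
  rw [sub_mul, mul_assoc, div_mul_cancel₀ _ hn]
  rw [Complex.normSq_apply] at hw ⊢
  simp only [Complex.sub_re, Complex.mul_re, Complex.one_re, Complex.sub_im, Complex.one_im,
    Complex.mul_im, Complex.ofReal_re, Complex.ofReal_im]
  linear_combination (-r ^ 2) * hw

theorem re_herglotz {u : Circle → ℝ} (hu : Measurable u) {U : ℝ}
    (h0 : ∀ t, 0 ≤ u t) (hU : ∀ t, u t ≤ U) {r : ℝ} (hr0 : 0 ≤ r) (hr1 : r < 1) (z : Circle) :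
    (herglotz u (r * z)).re = circleConv u (diskPoisson r) z := by
  have hx : ∀ s : Circle, ‖(r : ℂ) * (z * s⁻¹ : Circle)‖ < 1 := fun s => by
    rwa [norm_mul, Circle.norm_coe, mul_one, Complex.norm_real, Real.norm_of_nonneg hr0]
  have hrz : ‖(r : ℂ) * z‖ < 1 := by
    rwa [norm_mul, Circle.norm_coe, mul_one, Complex.norm_real, Real.norm_of_nonneg hr0]
  have huC : Measurable fun s => (u s : ℂ) := by fun_prop
  have hb : ∀ (k : ℕ) (s : Circle), ‖(u s : ℂ) * ((if k = 0 then 1 else 2) *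
      ((r : ℂ) * (z * s⁻¹ : Circle)) ^ k)‖ ≤ U * (2 * r ^ k) := by
    intro k s
    rw [norm_mul, norm_mul, norm_pow, norm_mul, Circle.norm_coe, mul_one, Complex.norm_real,
      Complex.norm_real, Real.norm_of_nonneg hr0, Real.norm_of_nonneg (h0 s)]
    have hd : ‖(if k = 0 then 1 else 2 : ℂ)‖ ≤ 2 := by split_ifs <;> simp
    exact mul_le_mul (hU s) (mul_le_mul_of_nonneg_right hd (by positivity)) (by positivity)
      ((h0 s).trans (hU s))
  have hi : ∀ k : ℕ, Integrable (fun s : Circle => (u s : ℂ) * ((if k = 0 then 1 else 2) *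
      ((r : ℂ) * (z * s⁻¹ : Circle)) ^ k)) circleMeasure := fun k => by
    refine integrable_of_bounded_circle ?_ _ (hb k)
    have : Continuous fun s : Circle => ((if k = 0 then 1 else 2) *
      ((r : ℂ) * (z * s⁻¹ : Circle)) ^ k) := by fun_prop
    exact huC.aestronglyMeasurable.mul this.aestronglyMeasurable
  have H := hasSum_integral_of_summable_integral_norm hi (by
    refine Summable.of_nonneg_of_le (fun k => integral_nonneg fun s => norm_nonneg _) (fun k => ?_)
      (((summable_geometric_of_lt_one hr0 hr1).mul_left 2).mul_left U)
    refine (integral_mono (hi k).norm (integrable_const _) (hb k)).trans (by simp))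
  have hK : ∀ s : Circle, ∑' k : ℕ, (u s : ℂ) * ((if k = 0 then 1 else 2) *
      ((r : ℂ) * (z * s⁻¹ : Circle)) ^ k) =
      (u s : ℂ) * (2 * (1 - (r : ℂ) * (z * s⁻¹ : Circle))⁻¹ - 1) := fun s =>
    ((hasSum_herglotzKernel (hx s)).mul_left _).tsum_eq
  have hco : ∀ k : ℕ, ∫ s : Circle, (u s : ℂ) * ((if k = 0 then 1 else 2) *
      ((r : ℂ) * (z * s⁻¹ : Circle)) ^ k) ∂circleMeasure = herglotzCoeff u k * (r * z) ^ k := by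
    intro k
    rw [herglotzCoeff, mul_right_comm, ← integral_const_mul]
    refine integral_congr_ae (Filter.Eventually.of_forall fun s => ?_)
    dsimp only
    rw [Circle.coe_mul]
    ring
  rw [funext hco, integral_congr_ae (Filter.Eventually.of_forall hK)] at H
  have hint : Integrable (fun s : Circle =>
      (u s : ℂ) * (2 * (1 - (r : ℂ) * (z * s⁻¹ : Circle))⁻¹ - 1)) circleMeasure := by
    have hcont : Continuous fun s : Circle =>
        (2 * (1 - (r : ℂ) * (z * s⁻¹ : Circle))⁻¹ - 1 : ℂ) := by
      refine Continuous.sub (continuous_const.mul (Continuous.inv₀ (by fun_prop) fun s => ?_))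
        continuous_const
      exact Circle.one_sub_mul_ne_zero hr0 hr1 _
    refine Integrable.bdd_mul (c := U)
      (hcont.integrable_of_hasCompactSupport (HasCompactSupport.of_compactSpace _))
      huC.aestronglyMeasurable (Filter.Eventually.of_forall fun t => ?_)
    rw [Complex.norm_real, Real.norm_of_nonneg (h0 t)]
    exact hU t
  rw [(hasSum_herglotz h0 hU hrz).unique H]
  have h3 := Complex.reCLM.integral_comp_comm hint
  rw [Complex.reCLM_apply] at h3
  rw [← h3, circleConv]
  refine integral_congr_ae (Filter.Eventually.of_forall fun s => ?_)
  dsimp only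
  rw [Complex.reCLM_apply, Complex.re_ofReal_mul, re_herglotzKernel hr0 hr1]

/-! ### Polynomial approximation of the outer function. -/

/-- By convexity `exp` lies below its chord on `[0, U]`. The bound is affine in `x`, so a Poisson
average of `exp(u * P_R)` is controlled by a Poisson average of `u`. -/
theorem exp_le_one_add_div_mul_exp {x U : ℝ} (hU : 0 < U) (h0 : 0 ≤ x) (h1 : x ≤ U) :
    Real.exp x ≤ 1 + Real.exp U / U * x := by
  have hx : 0 ≤ x / U := by positivity
  have hx1 : 0 ≤ 1 - x / U := by rw [sub_nonneg, div_le_one hU]; exact h1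
  have hc := convexOn_exp.2 (Set.mem_univ (0 : ℝ)) (Set.mem_univ U) hx1 hx (by ring)
  simp only [smul_eq_mul, mul_zero, zero_add, Real.exp_zero, mul_one] at hc
  rw [div_mul_cancel₀ _ hU.ne'] at hc
  calc Real.exp x ≤ 1 - x / U + x / U * Real.exp U := hc
    _ ≤ 1 + x / U * Real.exp U := by linarith
    _ = _ := by ring

/-- Near-best polynomial approximation on the circle of radius `r` of a function analytic in the
unit disk: the error is controlled by the Poisson average of the modulus. -/
theorem exists_polynomial_norm_le {f : ℂ → ℂ} (hf : DifferentiableOn ℂ f (Metric.ball 0 1))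
    {R σ : ℝ} (hR0 : 0 ≤ R) (hR1 : R < 1) (hσ0 : 0 ≤ σ) (hσ1 : σ < 1) (n : ℕ) :
    ∃ q : Polynomial ℂ, q.natDegree ≤ n ∧ q.eval 0 = f 0 ∧ ∀ z : Circle,
      ‖q.eval (z : ℂ)‖ ≤ ‖f ((R * σ : ℝ) * z)‖ +
        σ ^ (n + 1) * (∫ s : Circle, ‖f (R * s)‖ * diskPoisson σ (z * s⁻¹) ∂circleMeasure) +
        σ ^ (n + 1) * σ ^ (n + 1) * ‖f 0‖ := by
  set a : ℕ → ℂ := fun k => (k.factorial : ℂ)⁻¹ * iteratedDeriv k f 0 with ha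
  have hsum : ∀ z : ℂ, ‖z‖ < 1 → HasSum (fun k => a k * z ^ k) (f z) := by
    intro z hz
    have := Complex.hasSum_taylorSeries_on_ball hf (mem_ball_zero_iff.mpr hz)
    simp only [sub_zero, smul_eq_mul] at this
    refine this.congr_fun fun k => ?_
    rw [ha]
    ring
  have ha0 : f 0 = a 0 := by
    refine (hsum 0 (by simp)).unique ?_
    have := hasSum_single (f := fun k => a k * (0 : ℂ) ^ k) 0 (fun k hk => by simp [hk])
    simpa using this
  have hRs : ∀ s : Circle, ‖(R : ℂ) * s‖ < 1 := fun s => by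
    rwa [norm_mul, Circle.norm_coe, mul_one, Complex.norm_real, Real.norm_of_nonneg hR0]
  have hRσ : ∀ s : Circle, ‖((R * σ : ℝ) : ℂ) * s‖ < 1 := fun s => by
    rw [norm_mul, Circle.norm_coe, mul_one, Complex.norm_real,
      Real.norm_of_nonneg (mul_nonneg hR0 hσ0)]
    nlinarith
  set c : ℕ → ℂ := fun k => a k * (R : ℂ) ^ k with hc
  have hcs : Summable fun k => ‖c k‖ := by
    have := (hsum (R * (1 : Circle)) (hRs 1)).summable.norm
    simpa [hc] using this
  have hcf : ∀ s : Circle, ∑' k, c k * (s : ℂ) ^ k = f (R * s) := by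
    intro s
    rw [← (hsum (R * s) (hRs s)).tsum_eq]
    refine tsum_congr fun k => ?_
    rw [hc]
    ring
  -- Subtracting `σ^(n+1)` times the multiplier `σ^|k - (n+1)|` from `σ^k` gives exactly zero for `k
  -- ≥ n + 1`, so what is left has degree at most `n`. At `k = 0` it leaves the factor `1 -
  -- σ^(2(n+1))`; the constant added to the polynomial restores the value `f 0`.
  set b : ℕ → ℂ := fun k => c k * ((σ : ℂ) ^ k - (σ : ℂ) ^ (n + 1) * (σ : ℂ) ^ (n + 1 - k)) with hb
  refine ⟨∑ k ∈ Finset.range (n + 1), Polynomial.monomial k (b k) +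
    Polynomial.C ((σ : ℂ) ^ (n + 1) * (σ : ℂ) ^ (n + 1) * f 0), ?_, ?_, fun z => ?_⟩
  · refine Polynomial.natDegree_add_le_of_degree_le
      (Polynomial.natDegree_sum_le_of_forall_le _ _ fun k hk => ?_)
      (by rw [Polynomial.natDegree_C]; exact Nat.zero_le _)
    exact (Polynomial.natDegree_monomial_le _).trans (by
      have := Finset.mem_range.mp hk
      omega)
  · rw [Polynomial.eval_add, Polynomial.eval_C, Polynomial.eval_finsetSum,
      Finset.sum_eq_single 0]
    · rw [Polynomial.eval_monomial, hb, hc, ha0]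
      simp
      ring
    · intro k _ hk
      simp [Polynomial.eval_monomial, hk]
    · simp
  · set J : ℂ := ∫ s : Circle, f (R * s) * ((z * s⁻¹ : Circle) : ℂ) ^ ((n + 1 : ℕ) : ℤ) *
      (diskPoisson σ (z * s⁻¹) : ℂ) ∂circleMeasure with hJ
    have hH := hasSum_integral_mul_diskPoisson hσ0 hσ1 z ((n + 1 : ℕ) : ℤ) hcs
    simp_rw [hcf] at hH
    rw [← hJ] at hH
    have hF := (hsum _ (hRσ z)).sub (hH.mul_left ((σ : ℂ) ^ (n + 1)))
    have hq : ∑ k ∈ Finset.range (n + 1), b k * (z : ℂ) ^ k =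
        f ((R * σ : ℝ) * z) - (σ : ℂ) ^ (n + 1) * J := by
      refine HasSum.unique ?_ hF
      have h1 : ∀ k : ℕ, a k * (((R * σ : ℝ) : ℂ) * z) ^ k - (σ : ℂ) ^ (n + 1) *
          (c k * ((σ : ℂ) ^ ((k : ℤ) - ((n + 1 : ℕ) : ℤ)).natAbs * (z : ℂ) ^ k)) =
          if k < n + 1 then b k * (z : ℂ) ^ k else 0 := by
        intro k
        split_ifs with hk
        · have : ((k : ℤ) - ((n + 1 : ℕ) : ℤ)).natAbs = n + 1 - k := by omega
          rw [this, hb, hc]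
          push_cast
          ring
        · obtain ⟨d, rfl⟩ := Nat.exists_eq_add_of_le (not_lt.mp hk)
          have : (((n + 1 + d : ℕ) : ℤ) - ((n + 1 : ℕ) : ℤ)).natAbs = d := by omega
          rw [this, hc]
          push_cast
          ring
      rw [funext h1]
      have h2 := hasSum_sum_of_ne_finset_zero (s := Finset.range (n + 1))
        (f := fun k => if k < n + 1 then b k * (z : ℂ) ^ k else 0)
        (L := SummationFilter.unconditional ℕ)
        (fun k hk => by rw [Finset.mem_range] at hk; simp [hk])
      rwa [Finset.sum_congr rfl fun k hk => if_pos (Finset.mem_range.mp hk)] at h2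
    have hJn : ‖J‖ ≤ ∫ s : Circle, ‖f (R * s)‖ * diskPoisson σ (z * s⁻¹) ∂circleMeasure := by
      refine (norm_integral_le_integral_norm _).trans (le_of_eq ?_)
      refine integral_congr_ae (Filter.Eventually.of_forall fun s => ?_)
      dsimp only
      rw [norm_mul, norm_mul, norm_zpow, Circle.norm_coe, one_zpow, mul_one, Complex.norm_real,
        Real.norm_of_nonneg (diskPoisson_nonneg hσ0 hσ1 _)]
    rw [Polynomial.eval_add, Polynomial.eval_C, Polynomial.eval_finsetSum]
    simp_rw [Polynomial.eval_monomial]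
    rw [hq]
    have hσn : ‖(σ : ℂ) ^ (n + 1)‖ = σ ^ (n + 1) := by
      rw [norm_pow, Complex.norm_real, Real.norm_of_nonneg hσ0]
    refine (norm_add_le _ _).trans (add_le_add ((norm_sub_le _ _).trans (add_le_add le_rfl ?_)) ?_)
    · rw [norm_mul, hσn]
      exact mul_le_mul_of_nonneg_left hJn (by positivity)
    · rw [norm_mul, norm_mul, hσn]

/-- The semigroup law `P_R * P_σ = P_{Rσ}`, read off from the power series of the Herglotz
transform. -/
theorem integral_circleConv_diskPoisson {u : Circle → ℝ} (hu : Measurable u) {U : ℝ}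
    (h0 : ∀ t, 0 ≤ u t) (hU : ∀ t, u t ≤ U) {R σ : ℝ} (hR0 : 0 ≤ R) (hR1 : R < 1)
    (hσ0 : 0 ≤ σ) (hσ1 : σ < 1) (z : Circle) :
    ∫ s : Circle, circleConv u (diskPoisson R) s * diskPoisson σ (z * s⁻¹) ∂circleMeasure =
      circleConv u (diskPoisson (R * σ)) z := by
  have hRs : ∀ s : Circle, ‖(R : ℂ) * s‖ < 1 := fun s => by
    rwa [norm_mul, Circle.norm_coe, mul_one, Complex.norm_real, Real.norm_of_nonneg hR0]
  have hRσ1 : R * σ < 1 := by nlinarith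
  have hRσ : ‖((R * σ : ℝ) : ℂ) * z‖ < 1 := by
    rwa [norm_mul, Circle.norm_coe, mul_one, Complex.norm_real,
      Real.norm_of_nonneg (mul_nonneg hR0 hσ0)]
  set c : ℕ → ℂ := fun k => herglotzCoeff u k * (R : ℂ) ^ k with hc
  have hcs : Summable fun k => ‖c k‖ := by
    have := (hasSum_herglotz h0 hU (hRs 1)).summable.norm
    simpa [hc] using this
  have hcf : ∀ s : Circle, ∑' k, c k * (s : ℂ) ^ k = herglotz u (R * s) := by
    intro s
    rw [← (hasSum_herglotz h0 hU (hRs s)).tsum_eq]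
    refine tsum_congr fun k => ?_
    rw [hc]
    ring
  have hH := hasSum_integral_mul_diskPoisson hσ0 hσ1 z 0 hcs
  simp_rw [hcf, zpow_zero, mul_one, sub_zero, Int.natAbs_natCast] at hH
  have hG := hasSum_herglotz h0 hU hRσ
  have e : herglotz u (((R * σ : ℝ) : ℂ) * z) =
      ∫ s : Circle, herglotz u (R * s) * (diskPoisson σ (z * s⁻¹) : ℂ) ∂circleMeasure := by
    refine hG.unique (hH.congr_fun fun k => ?_)
    rw [hc]
    push_cast
    ring
  have hcont : Continuous fun s : Circle => herglotz u (R * s) := by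
    refine (differentiableOn_herglotz h0 hU).continuousOn.comp_continuous (by fun_prop) fun s => ?_
    exact mem_ball_zero_iff.mpr (hRs s)
  have hP : Continuous fun s : Circle => diskPoisson σ (z * s⁻¹) :=
    (continuous_diskPoisson hσ0 hσ1).comp (by fun_prop)
  have hint : Integrable (fun s : Circle =>
      herglotz u (R * s) * (diskPoisson σ (z * s⁻¹) : ℂ)) circleMeasure :=
    Continuous.integrable_of_hasCompactSupport (by fun_prop) (HasCompactSupport.of_compactSpace _)
  rw [← re_herglotz hu h0 hU (mul_nonneg hR0 hσ0) hRσ1, e, ← Complex.reCLM_apply,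
    ← Complex.reCLM.integral_comp_comm hint]
  refine integral_congr_ae (Filter.Eventually.of_forall fun s => ?_)
  dsimp only
  rw [Complex.reCLM_apply, Complex.re_mul_ofReal, re_herglotz hu h0 hU hR0 hR1]

theorem exists_polynomial_norm_le_exp_circleConv {u : Circle → ℝ} (hu : Measurable u) {U : ℝ}
    (hU0 : 0 < U) (h0 : ∀ t, 0 ≤ u t) (hU : ∀ t, u t ≤ U) {r : ℝ} (hr0 : 0 ≤ r) (hr1 : r < 1)
    {n : ℕ} (hn : r ^ (n + 1) ≤ Real.exp (-U)) :
    ∃ q : Polynomial ℂ, q.natDegree ≤ n ∧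
      q.eval 0 = (Real.exp (∫ s, u s ∂circleMeasure) : ℝ) ∧ ∀ z : Circle,
      ‖q.eval (z : ℂ)‖ ≤ Real.exp (circleConv u (diskPoisson r) z) + 6 * Real.exp (-U) +
        2 * circleConv u (diskPoisson r) z / U := by
  -- Factoring `r = Rσ` with `R < 1` avoids boundary values of the Herglotz transform. Taking
  -- `R^(n+1) > 1/2` costs only a factor 2 in `σ^(n+1) ≤ 2 exp(-U)`.
  obtain ⟨R, hrR, hR1, hRn⟩ : ∃ R : ℝ, r < R ∧ R < 1 ∧ 1 / 2 < R ^ (n + 1) := by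
    have hc : ContinuousAt (fun x : ℝ => x ^ (n + 1)) 1 := by fun_prop
    have h1 : ∀ᶠ x in nhdsWithin (1 : ℝ) (Set.Iio 1), 1 / 2 < x ^ (n + 1) :=
      (hc.eventually (lt_mem_nhds (by norm_num))).filter_mono nhdsWithin_le_nhds
    have h2 : ∀ᶠ x in nhdsWithin (1 : ℝ) (Set.Iio 1), r < x :=
      (lt_mem_nhds hr1).filter_mono nhdsWithin_le_nhds
    obtain ⟨R, ⟨h1, h2⟩, h3⟩ := ((h1.and h2).and self_mem_nhdsWithin).exists
    exact ⟨R, h2, h3, h1⟩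
  have hR0 : 0 < R := hr0.trans_lt hrR
  set σ := r / R with hσ
  have hσ0 : 0 ≤ σ := by positivity
  have hσ1 : σ < 1 := (div_lt_one hR0).mpr hrR
  have hRσ : R * σ = r := mul_div_cancel₀ r hR0.ne'
  have hσn : σ ^ (n + 1) ≤ 2 * Real.exp (-U) := by
    rw [hσ, div_pow, div_le_iff₀ (by positivity)]
    nlinarith [Real.exp_pos (-U)]
  have hd : DifferentiableOn ℂ (fun z => Complex.exp (herglotz u z)) (Metric.ball 0 1) :=
    (differentiableOn_herglotz h0 hU).cexp
  obtain ⟨q, hq1, hq2, hq3⟩ := exists_polynomial_norm_le hd hR0.le hR1 hσ0 hσ1 n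
  refine ⟨q, hq1, ?_, fun z => (hq3 z).trans ?_⟩
  · rw [hq2, herglotz_zero, Complex.ofReal_exp]
  rw [hRσ, Complex.norm_exp, Complex.norm_exp, re_herglotz hu h0 hU hr0 hr1, herglotz_zero,
    Complex.ofReal_re]
  set a := circleConv u (diskPoisson r) z with ha
  have hcontG : Continuous fun s : Circle => herglotz u (R * s) := by
    refine (differentiableOn_herglotz h0 hU).continuousOn.comp_continuous (by fun_prop) fun s => ?_
    rw [mem_ball_zero_iff, norm_mul, Circle.norm_coe, mul_one, Complex.norm_real,
      Real.norm_of_nonneg hR0.le]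
    exact hR1
  have hP : Continuous fun s : Circle => diskPoisson σ (z * s⁻¹) :=
    (continuous_diskPoisson hσ0 hσ1).comp (by fun_prop)
  have hcontC : Continuous fun s : Circle => circleConv u (diskPoisson R) s := by
    simp_rw [← re_herglotz hu h0 hU hR0.le hR1]
    fun_prop
  have hI : ∫ s : Circle, ‖Complex.exp (herglotz u (R * s))‖ * diskPoisson σ (z * s⁻¹)
      ∂circleMeasure ≤ 1 + Real.exp U / U * a := by
    calc _ ≤ ∫ s : Circle, (diskPoisson σ (z * s⁻¹) + Real.exp U / U *
          (circleConv u (diskPoisson R) s * diskPoisson σ (z * s⁻¹))) ∂circleMeasure := by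
          refine integral_mono
            (Continuous.integrable_of_hasCompactSupport (by fun_prop)
              (HasCompactSupport.of_compactSpace _))
            (Continuous.integrable_of_hasCompactSupport (by fun_prop)
              (HasCompactSupport.of_compactSpace _)) fun s => ?_
          dsimp only
          rw [Complex.norm_exp, re_herglotz hu h0 hU hR0.le hR1, ← mul_assoc, ← one_add_mul]
          exact mul_le_mul_of_nonneg_right (exp_le_one_add_div_mul_exp hU0
            (circleConv_diskPoisson_nonneg h0 hR0.le hR1 s)
            (circleConv_diskPoisson_le hu h0 hU hR0.le hR1 s)) (diskPoisson_nonneg hσ0 hσ1 _)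
      _ = 1 + Real.exp U / U * a := by
          rw [integral_add
            (Continuous.integrable_of_hasCompactSupport (by fun_prop)
              (HasCompactSupport.of_compactSpace _))
            (Continuous.integrable_of_hasCompactSupport (by fun_prop)
              (HasCompactSupport.of_compactSpace _)), integral_const_mul,
            integral_diskPoisson hσ0 hσ1,
            integral_circleConv_diskPoisson hu h0 hU hR0.le hR1 hσ0 hσ1, hRσ]
  have hm : ∫ s, u s ∂circleMeasure ≤ U := by
    have hi : Integrable u circleMeasure := integrable_of_bounded_circle hu.aestronglyMeasurable U
      fun t => by rw [Real.norm_of_nonneg (h0 t)]; exact hU t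
    refine (integral_mono hi (integrable_const U) hU).trans (by simp)
  have ha0 : 0 ≤ a := circleConv_diskPoisson_nonneg h0 hr0 hr1 z
  have hE : Real.exp (-U) * Real.exp U = 1 := by rw [← Real.exp_add]; simp
  have b1 : σ ^ (n + 1) * (∫ s : Circle, ‖Complex.exp (herglotz u (R * s))‖ *
      diskPoisson σ (z * s⁻¹) ∂circleMeasure) ≤ 2 * Real.exp (-U) + 2 * a / U := by
    calc _ ≤ 2 * Real.exp (-U) * (1 + Real.exp U / U * a) := by
          refine mul_le_mul hσn hI (integral_nonneg fun s => ?_) (by positivity)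
          exact mul_nonneg (norm_nonneg _) (diskPoisson_nonneg hσ0 hσ1 _)
      _ = 2 * Real.exp (-U) + 2 * a / U * (Real.exp (-U) * Real.exp U) := by ring
      _ = _ := by rw [hE, mul_one]
  have b2 : σ ^ (n + 1) * σ ^ (n + 1) * Real.exp (∫ s, u s ∂circleMeasure) ≤
      4 * Real.exp (-U) := by
    calc _ ≤ (2 * Real.exp (-U)) * (2 * Real.exp (-U)) * Real.exp U := by
          gcongr
      _ = 4 * Real.exp (-U) * (Real.exp (-U) * Real.exp U) := by ring
      _ = _ := by rw [hE, mul_one]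
  linarith

/-! ### The truncated weight, distances in `L²(ρ)`, and the upper bound. -/

theorem truncWeight_lt_top (W : Circle → ENNReal) (A : ℝ) (t : Circle) :
    truncWeight W A t ≠ ⊤ := ((min_le_right _ _).trans_lt ENNReal.ofReal_lt_top).ne

theorem measurable_logTrunc {W : Circle → ENNReal} (hW : Measurable W) (A : ℝ) :
    Measurable (logTrunc W A) :=
  Real.measurable_log.comp (hW.min measurable_const).ennreal_toReal

theorem one_le_toReal_truncWeight {W : Circle → ENNReal} (hW : ∀ t, 1 ≤ W t) {A : ℝ}
    (hA : 0 ≤ A) (t : Circle) : 1 ≤ (truncWeight W A t).toReal := by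
  have h : (1 : ENNReal) ≤ truncWeight W A t :=
    le_min (hW t) (by rw [ENNReal.one_le_ofReal]; exact Real.one_le_exp hA)
  simpa using ENNReal.toReal_mono (truncWeight_lt_top W A t) h

theorem logTrunc_nonneg {W : Circle → ENNReal} (hW : ∀ t, 1 ≤ W t) {A : ℝ}
    (hA : 0 ≤ A) (t : Circle) : 0 ≤ logTrunc W A t :=
  Real.log_nonneg (one_le_toReal_truncWeight hW hA t)

theorem logTrunc_le {W : Circle → ENNReal} (hW : ∀ t, 1 ≤ W t) {A : ℝ}
    (hA : 0 ≤ A) (t : Circle) : logTrunc W A t ≤ A := by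
  rw [logTrunc, Real.log_le_iff_le_exp (by linarith [one_le_toReal_truncWeight hW hA t])]
  exact ENNReal.toReal_le_of_le_ofReal (Real.exp_pos A).le (min_le_right _ _)

theorem ofReal_sq_dist_const_one {ρ : Measure Circle} [IsFiniteMeasure ρ] {f : Lp ℂ 2 ρ}
    {p : Polynomial ℂ} (hf : (f : Circle → ℂ) =ᵐ[ρ] fun t => p.eval (t : ℂ)) :
    ENNReal.ofReal (dist (Lp.const 2 ρ (1 : ℂ)) f ^ 2) =
      ∫⁻ t : Circle, ‖(1 - p).eval (t : ℂ)‖ₑ ^ 2 ∂ρ := by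
  rw [ENNReal.ofReal_pow dist_nonneg, ← edist_dist, Lp.edist_def]
  have h := eLpNorm_nnreal_pow_eq_lintegral (μ := ρ) (p := 2) (ε := ℂ)
    (f := ⇑(Lp.const 2 ρ (1 : ℂ)) - ⇑f) (by norm_num)
  simp only [NNReal.coe_ofNat, ENNReal.rpow_ofNat, ENNReal.coe_ofNat] at h
  rw [h]
  refine lintegral_congr_ae ?_
  filter_upwards [hf, Lp.coeFn_const 2 ρ (1 : ℂ)] with t h1 h2
  rw [Pi.sub_apply, h1, h2]
  simp

theorem exists_mem_polyZero (ρ : Measure Circle) [IsFiniteMeasure ρ] {n : ℕ} {p : Polynomial ℂ}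
    (hp : p.natDegree ≤ n) (hp0 : p.eval 0 = 0) :
    ∃ f ∈ polyZero ρ n, (f : Circle → ℂ) =ᵐ[ρ] fun t => p.eval (t : ℂ) := by
  have hc : Continuous fun t : Circle => p.eval (t : ℂ) := p.continuous.comp (by fun_prop)
  have hm : MemLp (fun t : Circle => p.eval (t : ℂ)) 2 ρ :=
    hc.memLp_of_hasCompactSupport (HasCompactSupport.of_compactSpace _)
  exact ⟨hm.toLp _, ⟨p, hp, hp0, hm.coeFn_toLp⟩, hm.coeFn_toLp⟩

/-- The competitor is `1 - q / b`, which vanishes at the origin and lies at distance `‖q‖ / b` from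
`1`. -/
theorem polyDist_le_of_lintegral_le (ρ : Measure Circle) [IsFiniteMeasure ρ] {n : ℕ}
    {q : Polynomial ℂ} (hq : q.natDegree ≤ n) {b : ℝ} (hb : 0 < b) (hq0 : q.eval 0 = (b : ℂ))
    {D : ℝ} (hD : 0 ≤ D) (h : ∫⁻ t : Circle, ‖q.eval (t : ℂ)‖ₑ ^ 2 ∂ρ ≤ ENNReal.ofReal D) :
    polyDist ρ n ≤ Real.sqrt D * b⁻¹ := by
  have hbC : (b : ℂ) ≠ 0 := by exact_mod_cast hb.ne'
  set p : Polynomial ℂ := 1 - Polynomial.C (b : ℂ)⁻¹ * q with hp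
  have hpd : p.natDegree ≤ n :=
    (Polynomial.natDegree_sub_le _ _).trans <|
    max_le (Polynomial.natDegree_one.trans_le (Nat.zero_le _)) ((Polynomial.natDegree_C_mul_le _ _).trans hq)
  obtain ⟨f, hf, hfp⟩ := exists_mem_polyZero ρ hpd (by
    rw [hp]; simp [hq0, hbC])
  refine (Metric.infDist_le_dist_of_mem hf).trans ?_
  refine (abs_le_of_sq_le_sq' ?_ (by positivity)).2
  have he := ofReal_sq_dist_const_one hfp
  have h1 : ∀ t : Circle, ‖(1 - p).eval (t : ℂ)‖ₑ ^ 2 =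
      ENNReal.ofReal (b⁻¹ ^ 2) * ‖q.eval (t : ℂ)‖ₑ ^ 2 := by
    intro t
    rw [hp, sub_sub_cancel, Polynomial.eval_mul, Polynomial.eval_C, enorm_mul, mul_pow,
      ENNReal.ofReal_pow (by positivity), ← Complex.ofReal_inv, ← ofReal_norm,
      Complex.norm_real, Real.norm_of_nonneg (by positivity)]
  simp_rw [h1] at he
  rw [lintegral_const_mul' _ _ ENNReal.ofReal_ne_top] at he
  rw [mul_pow, Real.sq_sqrt hD, mul_comm,
    ← ENNReal.ofReal_le_ofReal_iff (mul_nonneg (by positivity) hD), he,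
    ENNReal.ofReal_mul (by positivity)]
  gcongr

/-- If `a ≤ U/8`, the error is at most `1/2` and `(e + 1/2)² ≤ 2e² + 1/2`. Otherwise `a ≥ 2`, so `e
≥ 6` absorbs an error of at most `9/4`. -/
theorem sq_exp_add_le {a x e U : ℝ} (hU : 16 ≤ U) (haU : a ≤ U)
    (hx0 : 0 ≤ x) (hx : x ≤ Real.exp a + 6 * Real.exp (-U) + 2 * a / U) (he : Real.exp a ≤ e) :
    x ^ 2 ≤ 2 * e ^ 2 + 1 / 2 := by
  have hexp : Real.exp (-U) ≤ 1 / 24 := by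
    have h24 : 24 ≤ Real.exp U := by
      have h1 := Real.add_one_le_exp (U / 2)
      have : Real.exp U = Real.exp (U / 2) * Real.exp (U / 2) := by
        rw [← Real.exp_add]; ring_nf
      nlinarith
    rw [Real.exp_neg, one_div]
    exact inv_anti₀ (by norm_num) h24
  have hU0 : 0 < U := by linarith
  rcases le_total a (U / 8) with h | h
  · have : 2 * a / U ≤ 1 / 4 := by rw [div_le_iff₀ hU0]; linarith
    have hx' : x ≤ e + 1 / 2 := by linarith
    nlinarith [sq_nonneg (e - 1 / 2), Real.exp_pos a]
  · have : 2 * a / U ≤ 2 := by rw [div_le_iff₀ hU0]; linarith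
    have hx' : x ≤ e + 9 / 4 := by linarith
    have he6 : 6 ≤ e := by
      have h2 : Real.exp 1 * Real.exp 1 ≤ Real.exp a := by
        rw [← Real.exp_add]
        exact Real.exp_le_exp.mpr (by linarith)
      nlinarith [Real.exp_one_gt_d9]
    nlinarith

theorem polyDist_le_of_circleConv_logTrunc_le {β M A : ℝ} (hβ : 0 < β) (hM : 0 < M)
    (hA : 2 + 32 * M / β ≤ A) (ρ : Measure Circle) [IsFiniteMeasure ρ] {W : Circle → ENNReal}
    (hWm : Measurable W) (hW : ∀ t, 1 ≤ W t) {C : ℝ} (hC : 0 ≤ C)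
    (hρ : ∫⁻ t, W t ^ β ∂ρ ≤ ENNReal.ofReal C)
    (hconv : ∀ t, ((circleConv (logTrunc W A) (diskPoisson (1 - A⁻¹)) t : ℝ) : EReal)
      ≤ (M : EReal) * ENNReal.log (W t)) {n : ℕ} (hn : A ^ 2 * β / (2 * M) ≤ (n : ℝ)) :
    polyDist ρ n ≤ Real.sqrt (2 * C + 1 / 2 * ρ.real Set.univ) *
      Real.exp (-(β / (2 * M)) * ∫ t, logTrunc W A t ∂circleMeasure) := by
  have hMβ : 0 < 32 * M / β := by positivity
  have hA0 : 0 < A := by linarith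
  have hA1 : 1 < A := by linarith
  -- This scaling turns the bound `M log W` into `(β/2) log W`, so that squaring the exponential
  -- yields `W^β`.
  set κ := β / (2 * M) with hκ
  have hκ0 : 0 < κ := by positivity
  set U := κ * A with hU
  have hU16 : 16 ≤ U := by
    have : κ * (32 * M / β) = 16 := by rw [hκ]; field_simp; norm_num
    nlinarith
  have hU0 : 0 < U := by linarith
  set r := 1 - A⁻¹ with hr
  have hr0 : 0 ≤ r := by rw [hr, sub_nonneg]; exact inv_le_one_of_one_le₀ hA1.le
  have hr1 : r < 1 := by rw [hr]; linarith [inv_pos.mpr hA0]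
  set u : Circle → ℝ := fun t => κ * logTrunc W A t with hu
  have hum : Measurable u := (measurable_logTrunc hWm A).const_mul κ
  have hu0 : ∀ t, 0 ≤ u t := fun t => mul_nonneg hκ0.le (logTrunc_nonneg hW hA0.le t)
  have huU : ∀ t, u t ≤ U := fun t =>
    mul_le_mul_of_nonneg_left (logTrunc_le hW hA0.le t) hκ0.le
  -- Here `r ≤ exp(-1/A)`, and `n / A ≥ κA = U` is exactly the hypothesis on `n`.
  have hrn : r ^ (n + 1) ≤ Real.exp (-U) := by
    have h1 : r ≤ Real.exp (-A⁻¹) := by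
      have := Real.add_one_le_exp (-A⁻¹)
      rw [hr]; linarith
    refine (pow_le_pow_left₀ hr0 h1 _).trans ?_
    rw [← Real.exp_nat_mul, Real.exp_le_exp]
    have h2 : U ≤ n * A⁻¹ := by
      rw [← div_eq_mul_inv, le_div_iff₀ hA0, hU, hκ]
      calc β / (2 * M) * A * A = A ^ 2 * β / (2 * M) := by ring
        _ ≤ n := hn
    push_cast
    have := inv_pos.mpr hA0
    nlinarith
  obtain ⟨q, hqn, hq0, hq⟩ := exists_polynomial_norm_le_exp_circleConv hum hU0 hu0 huU hr0 hr1 hrn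
  have hint : ∫ s, u s ∂circleMeasure = κ * ∫ t, logTrunc W A t ∂circleMeasure :=
    integral_const_mul _ _
  have hcu : ∀ t, circleConv u (diskPoisson r) t =
      κ * circleConv (logTrunc W A) (diskPoisson r) t := by
    intro t
    rw [circleConv, circleConv, ← integral_const_mul]
    refine integral_congr_ae (Filter.Eventually.of_forall fun s => ?_)
    simp only [hu]
    ring
  have hpt : ∀ t : Circle, ‖q.eval (t : ℂ)‖ₑ ^ 2 ≤ 2 * W t ^ β + ENNReal.ofReal (1 / 2) := by
    intro t
    -- Where `W` is infinite the convolution hypothesis says nothing, but the right-hand side is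
    -- infinite too.
    rcases eq_or_ne (W t) ⊤ with hWt | hWt
    · rw [hWt, ENNReal.top_rpow_of_pos hβ]
      simp
    have hw1 : 1 ≤ (W t).toReal := by simpa using ENNReal.toReal_mono hWt (hW t)
    have hWe : W t = ENNReal.ofReal (W t).toReal := (ENNReal.ofReal_toReal hWt).symm
    generalize (W t).toReal = w at hw1 hWe
    have hw0 : 0 < w := by linarith
    have hc := hconv t
    rw [hWe, ENNReal.log_ofReal_of_pos hw0, ← EReal.coe_mul, EReal.coe_le_coe_iff] at hc
    have ha : circleConv u (diskPoisson r) t ≤ Real.log w * (β / 2) := by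
      rw [hcu]
      calc _ ≤ κ * (M * Real.log w) := mul_le_mul_of_nonneg_left hc hκ0.le
        _ = _ := by rw [hκ]; field_simp
    have he : Real.exp (circleConv u (diskPoisson r) t) ≤ w ^ (β / 2) := by
      rw [Real.rpow_def_of_pos hw0]
      exact Real.exp_le_exp.mpr ha
    have hsq := sq_exp_add_le hU16
      (circleConv_diskPoisson_le hum hu0 huU hr0 hr1 t) (norm_nonneg _) (hq t) he
    have hwβ : (w ^ (β / 2)) ^ 2 = w ^ β := by
      rw [← Real.rpow_natCast, ← Real.rpow_mul hw0.le]
      congr 1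
      push_cast
      ring
    rw [hwβ] at hsq
    rw [← ofReal_norm, ← ENNReal.ofReal_pow (norm_nonneg _), hWe,
      ENNReal.ofReal_rpow_of_pos hw0]
    calc _ ≤ ENNReal.ofReal (2 * w ^ β + 1 / 2) := ENNReal.ofReal_le_ofReal hsq
      _ = _ := by
        rw [ENNReal.ofReal_add (by positivity) (by norm_num), ENNReal.ofReal_mul (by norm_num),
          ENNReal.ofReal_ofNat]
  have hl : ∫⁻ t : Circle, ‖q.eval (t : ℂ)‖ₑ ^ 2 ∂ρ ≤
      ENNReal.ofReal (2 * C + 1 / 2 * ρ.real Set.univ) := by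
    calc _ ≤ ∫⁻ t, (2 * W t ^ β + ENNReal.ofReal (1 / 2)) ∂ρ := lintegral_mono hpt
      _ = 2 * ∫⁻ t, W t ^ β ∂ρ + ENNReal.ofReal (1 / 2) * ρ Set.univ := by
        rw [lintegral_add_right _ measurable_const, lintegral_const,
          lintegral_const_mul _ (hWm.pow_const β)]
      _ ≤ 2 * ENNReal.ofReal C + ENNReal.ofReal (1 / 2) * ρ Set.univ := by gcongr
      _ = _ := by
        rw [ENNReal.ofReal_add (by positivity) (by positivity), ENNReal.ofReal_mul (by norm_num),
          ENNReal.ofReal_mul (by norm_num), ENNReal.ofReal_ofNat, ofReal_measureReal]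
  refine (polyDist_le_of_lintegral_le ρ hqn (Real.exp_pos _) hq0 (by positivity) hl).trans
    (le_of_eq ?_)
  rw [← Real.exp_neg, hint, neg_mul]

/-! ### Mahler measure and the lower bound. -/

theorem coe_circleExp_eq_circleMap (θ : ℝ) : ((Circle.exp θ : Circle) : ℂ) = circleMap 0 1 θ := by
  simp [circleMap, Circle.coe_exp]

theorem measurable_log_norm_eval (p : Polynomial ℂ) :
    Measurable fun t : Circle => Real.log ‖p.eval (t : ℂ)‖ :=
  Real.measurable_log.comp (p.continuous.comp (by fun_prop :
    Continuous fun t : Circle => (t : ℂ))).norm.measurable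

/-- Passes between the interval from `0` to `2π` of the Mahler measure and the interval from `-π` to
`π` of `circleMeasure`. -/
theorem periodic_log_norm_eval (p : Polynomial ℂ) :
    Function.Periodic (fun θ => Real.log ‖p.eval (circleMap 0 1 θ)‖) (2 * Real.pi) := fun θ => by
  dsimp only
  rw [periodic_circleMap]

theorem integrable_log_norm_eval (p : Polynomial ℂ) :
    Integrable (fun t : Circle => Real.log ‖p.eval (t : ℂ)‖) circleMeasure := by
  have h : IntervalIntegrable (fun θ => Real.log ‖p.eval (circleMap 0 1 θ)‖) volume
      (-Real.pi) Real.pi :=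
    (periodic_log_norm_eval p).intervalIntegrable (t := 0) (by positivity)
      (by simpa using p.intervalIntegrable_mahlerMeasure) _ _
  rw [intervalIntegrable_iff_integrableOn_Ioc_of_le (by linarith [Real.pi_pos])] at h
  unfold circleMeasure
  rw [integrable_map_measure (measurable_log_norm_eval p).aestronglyMeasurable
    Circle.exp.continuous.measurable.aemeasurable]
  simp only [Function.comp_def, coe_circleExp_eq_circleMap]
  exact Integrable.smul_measure h (ENNReal.inv_ne_top.mpr (by simp [Real.pi_pos]))

theorem integral_log_norm_eval (p : Polynomial ℂ) :
    ∫ t : Circle, Real.log ‖p.eval (t : ℂ)‖ ∂circleMeasure = p.logMahlerMeasure := by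
  rw [integral_circleMeasure (measurable_log_norm_eval p).aestronglyMeasurable,
    Polynomial.logMahlerMeasure_def, Real.circleAverage_def]
  simp only [coe_circleExp_eq_circleMap]
  congr 1
  have := (periodic_log_norm_eval p).intervalIntegral_add_eq (-Real.pi) 0
  rw [zero_add, show -Real.pi + 2 * Real.pi = Real.pi by ring] at this
  exact this

theorem ae_eval_ne_zero {p : Polynomial ℂ} (hp : p ≠ 0) :
    ∀ᵐ t : Circle ∂circleMeasure, p.eval (t : ℂ) ≠ 0 := by
  rw [ae_iff]
  refine Set.Finite.measure_zero ?_ _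
  simp only [not_not]
  exact (Polynomial.finite_setOfPred_isRoot hp).preimage (Subtype.val_injective.injOn)

/-- The `i`-th coefficient is at most `choose d i` times the Mahler measure, and these binomials sum
to `2^d`. -/
theorem norm_eval_le_two_pow_mul_mahlerMeasure (p : Polynomial ℂ) (t : Circle) :
    ‖p.eval (t : ℂ)‖ ≤ 2 ^ p.natDegree * p.mahlerMeasure := by
  rw [Polynomial.eval_eq_sum_range]
  refine (norm_sum_le _ _).trans ?_
  have h2 : (2 : ℝ) ^ p.natDegree =
      ∑ i ∈ Finset.range (p.natDegree + 1), ((p.natDegree.choose i : ℕ) : ℝ) := by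
    exact_mod_cast (Nat.sum_range_choose p.natDegree).symm
  rw [h2, Finset.sum_mul]
  refine Finset.sum_le_sum fun i _ => ?_
  rw [norm_mul, norm_pow, Circle.norm_coe, one_pow, mul_one]
  exact p.norm_coeff_le_choose_mul_mahlerMeasure i

/-- Off a small set the mean of `log |p|` is bounded below, when `p` is normalized at `0`. -/
theorem neg_le_setIntegral_log_norm_eval {p : Polynomial ℂ} (hp0 : p.eval 0 = 1) {n : ℕ}
    (hn : p.natDegree ≤ n) {S : Set Circle} (hS : MeasurableSet S) :
    -(n * circleMeasure.real Sᶜ * Real.log 2) ≤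
      ∫ t in S, Real.log ‖p.eval (t : ℂ)‖ ∂circleMeasure := by
  have hp : p ≠ 0 := by rintro rfl; simp at hp0
  set L := p.logMahlerMeasure with hL
  have hmah : p.mahlerMeasure = Real.exp L := Polynomial.mahlerMeasure_def_of_ne_zero hp
  have hL0 : 0 ≤ L := by
    have h := p.norm_coeff_le_choose_mul_mahlerMeasure 0
    rw [Polynomial.coeff_zero_eq_eval_zero, hp0, norm_one, Nat.choose_zero_right, Nat.cast_one,
      one_mul, hmah] at h
    exact Real.one_le_exp_iff.mp h
  have hlog2 : 0 < Real.log 2 := Real.log_pos (by norm_num)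
  have hle : ∀ t : Circle, Real.log ‖p.eval (t : ℂ)‖ ≤ n * Real.log 2 + L := by
    intro t
    -- At a zero of `p` the convention `log 0 = 0` applies, and the bound holds because `L ≥ 0`.
    rcases eq_or_ne (p.eval (t : ℂ)) 0 with h | h
    · rw [h, norm_zero, Real.log_zero]
      positivity
    rw [Real.log_le_iff_le_exp (norm_pos_iff.mpr h), Real.exp_add, Real.exp_nat_mul,
      Real.exp_log (by norm_num), ← hmah]
    refine (norm_eval_le_two_pow_mul_mahlerMeasure p t).trans ?_
    exact mul_le_mul_of_nonneg_right (pow_le_pow_right₀ (by norm_num) hn) p.mahlerMeasure_nonneg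
  have hsplit := integral_add_compl hS (integrable_log_norm_eval p)
  rw [integral_log_norm_eval, ← hL] at hsplit
  -- Subtracted from the full mean `L`, this leaves `(1 - m(Sᶜ)) L ≥ 0` besides the stated loss.
  have hcompl : ∫ t in Sᶜ, Real.log ‖p.eval (t : ℂ)‖ ∂circleMeasure ≤
      circleMeasure.real Sᶜ * (n * Real.log 2 + L) := by
    refine (integral_mono (integrable_log_norm_eval p).integrableOn (integrable_const _)
      hle).trans (le_of_eq ?_)
    rw [setIntegral_const, smul_eq_mul]
  have hm : circleMeasure.real Sᶜ ≤ 1 := measureReal_le_one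
  nlinarith

/-- The tangent line of `exp` at `c`, evaluated at `log x`. Integrated with a suitable constant `c`,
it plays the role of Jensen's inequality. -/
theorem exp_mul_one_add_log_sub_le {x c : ℝ} (hx : 0 < x) :
    Real.exp c * (1 + Real.log x - c) ≤ x := by
  have h := Real.add_one_le_exp (Real.log x - c)
  calc Real.exp c * (1 + Real.log x - c) ≤ Real.exp c * Real.exp (Real.log x - c) :=
        mul_le_mul_of_nonneg_left (by linarith) (Real.exp_pos c).le
    _ = x := by rw [← Real.exp_add, add_sub_cancel, Real.exp_log hx]

theorem le_setIntegral_norm_eval_sq_mul_exp {q : Polynomial ℂ} (hq0 : q.eval 0 = 1) {n : ℕ}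
    (hn : q.natDegree ≤ n) {S : Set Circle} (hS : MeasurableSet S) {H : Circle → ℝ}
    (hH : Measurable H) {A : ℝ} (hH0 : ∀ t, 0 ≤ H t) (hHA : ∀ t, H t ≤ A)
    (hHS : ∀ t ∈ Sᶜ, H t = A) {β K δ : ℝ} (hβ : 0 < β) (hδ : 0 < δ) (hK0 : 0 < K)
    (hK : n * circleMeasure.real Sᶜ ≤ K) (hSδ : δ ≤ circleMeasure.real S) :
    δ * Real.exp (-(2 * K * Real.log 2 / δ) - β * ∫ t, H t ∂circleMeasure) ≤
      ∫ t in S, ‖q.eval (t : ℂ)‖ ^ 2 * Real.exp (-(β * H t)) ∂circleMeasure := by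
  have hq : q ≠ 0 := by rintro rfl; simp at hq0
  have hlog2 : 0 < Real.log 2 := Real.log_pos (by norm_num)
  have hlogq := neg_le_setIntegral_log_norm_eval hq0 hn hS
  have hHi : Integrable H circleMeasure := integrable_of_bounded_circle hH.aestronglyMeasurable A
    fun t => by rw [Real.norm_of_nonneg (hH0 t)]; exact hHA t
  set I := ∫ t, H t ∂circleMeasure with hI
  set s := circleMeasure.real S with hs
  have hsc : circleMeasure.real Sᶜ = 1 - s := by
    rw [measureReal_compl hS, probReal_univ]
  have hs1 : s ≤ 1 := measureReal_le_one
  have hIA : I ≤ A := (integral_mono hHi (integrable_const A) hHA).trans (by simp)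
  -- `H` takes its maximal value `A` off `S`, so its average over `S` cannot exceed its average over
  -- the circle.
  have hHint : ∫ t in S, H t ∂circleMeasure ≤ s * I := by
    have h1 := integral_add_compl hS hHi
    rw [setIntegral_congr_fun hS.compl hHS, setIntegral_const, hsc, smul_eq_mul, ← hI] at h1
    nlinarith
  -- A lower bound for the average over `S` of `2 log |q| - βH`; with this `c` the integrated
  -- tangent line is at least `exp(c) m(S)`.
  set c := -(2 * K * Real.log 2 / δ) - β * I with hc
  have hqc : Continuous fun t : Circle => q.eval (t : ℂ) := q.continuous.comp (by fun_prop)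
  have hli := integrable_log_norm_eval q
  have hyi : Integrable (fun t : Circle => ‖q.eval (t : ℂ)‖ ^ 2 * Real.exp (-(β * H t)))
      circleMeasure := by
    refine Integrable.mul_bdd (c := 1) ((hqc.norm.pow 2).integrable_of_hasCompactSupport
      (HasCompactSupport.of_compactSpace _)) (by fun_prop)
      (Filter.Eventually.of_forall fun t => ?_)
    rw [Real.norm_of_nonneg (Real.exp_pos _).le, Real.exp_le_one_iff, neg_nonpos]
    exact mul_nonneg hβ.le (hH0 t)
  have hdi : Integrable (fun t : Circle => 2 * Real.log ‖q.eval (t : ℂ)‖ - β * H t)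
      circleMeasure := (hli.const_mul 2).sub (hHi.const_mul β)
  have hxi : Integrable (fun t : Circle => Real.exp c *
      (1 - c + (2 * Real.log ‖q.eval (t : ℂ)‖ - β * H t))) circleMeasure :=
    ((integrable_const (1 - c)).add hdi).const_mul _
  have key : ∫ t in S, Real.exp c * (1 - c + (2 * Real.log ‖q.eval (t : ℂ)‖ - β * H t))
      ∂circleMeasure ≤ ∫ t in S, ‖q.eval (t : ℂ)‖ ^ 2 * Real.exp (-(β * H t)) ∂circleMeasure := by
    refine setIntegral_mono_ae hxi.integrableOn hyi.integrableOn ?_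
    filter_upwards [ae_eval_ne_zero hq] with t ht
    have hn0 : 0 < ‖q.eval (t : ℂ)‖ := norm_pos_iff.mpr ht
    have h := exp_mul_one_add_log_sub_le (c := c)
      (x := ‖q.eval (t : ℂ)‖ ^ 2 * Real.exp (-(β * H t))) (by positivity)
    rw [Real.log_mul (by positivity) (Real.exp_pos _).ne', Real.log_pow, Real.log_exp] at h
    refine le_trans (le_of_eq ?_) h
    push_cast
    ring
  refine le_trans ?_ key
  rw [integral_const_mul, integral_add (integrable_const _) hdi.integrableOn,
    integral_sub (hli.const_mul 2).integrableOn (hHi.const_mul β).integrableOn,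
    integral_const_mul, integral_const_mul, setIntegral_const, smul_eq_mul, ← hs]
  rw [mul_comm δ]
  refine mul_le_mul_of_nonneg_left ?_ (Real.exp_pos c).le
  have hKδ : K * Real.log 2 ≤ s * (K * Real.log 2 / δ) := by
    rw [mul_div_assoc', le_div_iff₀ hδ]
    nlinarith [mul_pos hK0 hlog2]
  have hK2 : n * circleMeasure.real Sᶜ * Real.log 2 ≤ K * Real.log 2 :=
    mul_le_mul_of_nonneg_right hK hlog2.le
  have hb : β * ∫ t in S, H t ∂circleMeasure ≤ β * (s * I) :=
    mul_le_mul_of_nonneg_left hHint hβ.le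
  have hcs : s * c = -(2 * (s * (K * Real.log 2 / δ))) - β * (s * I) := by rw [hc]; ring
  linarith [mul_sub s 1 c]

theorem le_polyDist_of_withDensity_le {c₀ K δ : ℝ} (hc₀ : 0 < c₀) (hK0 : 0 < K) (hδ : 0 < δ)
    {β A : ℝ} (hβ : 0 < β) (hA : 0 ≤ A) (ρ : Measure Circle) [IsFiniteMeasure ρ]
    {W : Circle → ENNReal} (hWm : Measurable W) (hW : ∀ t, 1 ≤ W t)
    (hρ : circleMeasure.withDensity (fun t => ENNReal.ofReal c₀ * W t ^ (-β)) ≤ ρ) {n : ℕ}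
    (hK : (n : ℝ) * circleMeasure.real {t | ENNReal.ofReal (Real.exp A) < W t} ≤ K)
    (hSδ : δ ≤ circleMeasure.real {t | W t ≤ ENNReal.ofReal (Real.exp A)}) :
    Real.sqrt (c₀ * δ * Real.exp (-(2 * K * Real.log 2 / δ))) *
      Real.exp (-(β / 2) * ∫ t, logTrunc W A t ∂circleMeasure) ≤ polyDist ρ n := by
  set S : Set Circle := {t | W t ≤ ENNReal.ofReal (Real.exp A)} with hSdef
  have hS : MeasurableSet S := measurableSet_le hWm measurable_const
  have hSc : Sᶜ = {t | ENNReal.ofReal (Real.exp A) < W t} := by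
    ext t
    simp [hSdef]
  rw [← hSc] at hK
  have hHS : ∀ t ∈ Sᶜ, logTrunc W A t = A := by
    intro t ht
    rw [hSc] at ht
    rw [logTrunc, truncWeight, min_eq_right (le_of_lt ht),
      ENNReal.toReal_ofReal (Real.exp_pos A).le, Real.log_exp]
  -- `Metric.infDist` to the empty set is `0`, so a lower bound needs a witness; the zero polynomial
  -- serves.
  obtain ⟨f₀, hf₀, -⟩ := exists_mem_polyZero ρ (n := n) (p := 0) (by simp) (by simp)
  refine (Metric.le_infDist ⟨f₀, hf₀⟩).mpr ?_
  rintro f ⟨p, hpn, hp0, hfp⟩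
  refine (abs_le_of_sq_le_sq' ?_ dist_nonneg).2
  rw [← ENNReal.ofReal_le_ofReal_iff (by positivity), ofReal_sq_dist_const_one hfp]
  set q := 1 - p with hq
  have hqn : q.natDegree ≤ n := (Polynomial.natDegree_sub_le _ _).trans <|
    max_le (Polynomial.natDegree_one.trans_le (Nat.zero_le _)) hpn
  have hq0 : q.eval 0 = 1 := by simp [hq, hp0]
  have hH := measurable_logTrunc hWm A
  have hreal := le_setIntegral_norm_eval_sq_mul_exp hq0 hqn hS hH (logTrunc_nonneg hW hA)
    (logTrunc_le hW hA) hHS hβ hδ hK0 hK hSδ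
  have hqc : Continuous fun t : Circle => q.eval (t : ℂ) := q.continuous.comp (by fun_prop)
  have hyi : Integrable (fun t : Circle => ‖q.eval (t : ℂ)‖ ^ 2 *
      Real.exp (-(β * logTrunc W A t))) circleMeasure := by
    refine Integrable.mul_bdd (c := 1) ((hqc.norm.pow 2).integrable_of_hasCompactSupport
      (HasCompactSupport.of_compactSpace _)) (by fun_prop)
      (Filter.Eventually.of_forall fun t => ?_)
    rw [Real.norm_of_nonneg (Real.exp_pos _).le, Real.exp_le_one_iff, neg_nonpos]
    exact mul_nonneg hβ.le (logTrunc_nonneg hW hA t)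
  have hsq : (Real.sqrt (c₀ * δ * Real.exp (-(2 * K * Real.log 2 / δ))) *
      Real.exp (-(β / 2) * ∫ t, logTrunc W A t ∂circleMeasure)) ^ 2 = c₀ * (δ * Real.exp
      (-(2 * K * Real.log 2 / δ) - β * ∫ t, logTrunc W A t ∂circleMeasure)) := by
    rw [mul_pow, Real.sq_sqrt (by positivity), ← Real.exp_nat_mul, sub_eq_add_neg, Real.exp_add,
      mul_assoc, mul_assoc]
    congr 4
    push_cast
    ring
  have hqm : Measurable fun t : Circle => ‖q.eval (t : ℂ)‖ₑ ^ 2 := hqc.measurable.enorm.pow_const 2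
  have hdm : Measurable fun t => ENNReal.ofReal c₀ * W t ^ (-β) :=
    (hWm.pow_const (-β)).const_mul _
  calc _ ≤ ENNReal.ofReal (c₀ * ∫ t in S, ‖q.eval (t : ℂ)‖ ^ 2 *
        Real.exp (-(β * logTrunc W A t)) ∂circleMeasure) := by
        rw [hsq]
        exact ENNReal.ofReal_le_ofReal (mul_le_mul_of_nonneg_left hreal hc₀.le)
    _ = ∫⁻ t in S, ENNReal.ofReal c₀ * ENNReal.ofReal (‖q.eval (t : ℂ)‖ ^ 2 *
        Real.exp (-(β * logTrunc W A t))) ∂circleMeasure := by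
        rw [ENNReal.ofReal_mul hc₀.le, ofReal_integral_eq_lintegral_ofReal hyi.integrableOn
          (Filter.Eventually.of_forall fun t => by positivity),
          lintegral_const_mul' _ _ ENNReal.ofReal_ne_top]
    _ = ∫⁻ t in S, (ENNReal.ofReal c₀ * W t ^ (-β)) * ‖q.eval (t : ℂ)‖ₑ ^ 2 ∂circleMeasure := by
        refine setLIntegral_congr_fun hS fun t ht => ?_
        have hWt : W t ≠ ⊤ := ((show W t ≤ _ from ht).trans_lt ENNReal.ofReal_lt_top).ne
        have htr : truncWeight W A t = W t := min_eq_left ht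
        have hw1 : 1 ≤ (W t).toReal := by simpa using ENNReal.toReal_mono hWt (hW t)
        have hw0 : 0 < (W t).toReal := by linarith
        have hlog : Real.exp (-(β * logTrunc W A t)) = (W t).toReal ^ (-β) := by
          rw [logTrunc, htr, Real.rpow_def_of_pos hw0]
          congr 1
          ring
        rw [hlog, ENNReal.ofReal_mul (by positivity), ← ENNReal.ofReal_rpow_of_pos hw0,
          ENNReal.ofReal_toReal hWt, ENNReal.ofReal_pow (norm_nonneg _), ofReal_norm]
        ring
    _ ≤ ∫⁻ t, (ENNReal.ofReal c₀ * W t ^ (-β)) * ‖q.eval (t : ℂ)‖ₑ ^ 2 ∂circleMeasure :=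
        setLIntegral_le_lintegral _ _
    _ = ∫⁻ t : Circle, ‖q.eval (t : ℂ)‖ₑ ^ 2
        ∂(circleMeasure.withDensity fun t => ENNReal.ofReal c₀ * W t ^ (-β)) :=
        (lintegral_withDensity_eq_lintegral_mul _ hdm hqm).symm
    _ ≤ _ := lintegral_mono' hρ le_rfl

theorem theorem5p2 :
    ∃ A₀ : ℝ → ℝ → ℝ, (∀ β M : ℝ, 0 < β → 0 < M → 1 < A₀ β M) ∧
      -- Part (A)
      (∀ β M A : ℝ, 0 < β → 0 < M → A₀ β M ≤ A →
        ∀ (ρ : Measure Circle) [IsFiniteMeasure ρ] (W : Circle → ENNReal),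
          Measurable W → (∀ t, 1 ≤ W t) →
        ∀ C : ℝ, 0 ≤ C →
          ∫⁻ t, W t ^ β ∂ρ ≤ ENNReal.ofReal C →
          (∀ t, ((circleConv (logTrunc W A) (diskPoisson (1 - A⁻¹)) t : ℝ) : EReal)
            ≤ (M : EReal) * ENNReal.log (W t)) →
        ∀ n : ℕ, A ^ 2 * β / (2 * M) ≤ (n : ℝ) →
          polyDist ρ n ≤ Real.sqrt (2 * C + 1 / 2 * ρ.real Set.univ) *
            Real.exp (-(β / (2 * M)) * ∫ t, logTrunc W A t ∂circleMeasure)) ∧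
      -- Part (B)
      (∀ c₀ K δ : ℝ, 0 < c₀ → 0 < K → 0 < δ → ∃ c : ℝ, 0 < c ∧
        ∀ β M A : ℝ, 0 < β → 0 < M → A₀ β M ≤ A →
        ∀ (ρ : Measure Circle) [IsFiniteMeasure ρ] (W : Circle → ENNReal),
          Measurable W → (∀ t, 1 ≤ W t) →
          circleMeasure.withDensity (fun t => ENNReal.ofReal c₀ * W t ^ (-β)) ≤ ρ →
        ∀ n : ℕ,
          (n : ℝ) * circleMeasure.real {t | ENNReal.ofReal (Real.exp A) < W t} ≤ K →
          δ ≤ circleMeasure.real {t | W t ≤ ENNReal.ofReal (Real.exp A)} →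
          c * Real.exp (-(β / 2) * ∫ t, logTrunc W A t ∂circleMeasure) ≤ polyDist ρ n) := by
  -- The term `32M/β` gives `U = βA/(2M) ≥ 16`, as `sq_exp_add_le` requires; the `2` ensures `A >
  -- 1`, hence `0 ≤ 1 - 1/A < 1`.
  refine ⟨fun β M => 2 + 32 * M / β, fun β M hβ hM => ?_, ?_, ?_⟩
  · have : 0 < 32 * M / β := by positivity
    linarith
  · intro β M A hβ hM hA ρ _ W hWm hW C hC hρ hconv n hn
    exact polyDist_le_of_circleConv_logTrunc_le hβ hM hA ρ hWm hW hC hρ hconv hn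
  · intro c₀ K δ hc₀ hK hδ
    refine ⟨Real.sqrt (c₀ * δ * Real.exp (-(2 * K * Real.log 2 / δ))), by positivity, ?_⟩
    intro β M A hβ hM hA ρ _ W hWm hW hρ n hnK hSδ
    have hA0 : 0 ≤ A := by
      have : 0 < 32 * M / β := by positivity
      linarith
    exact le_polyDist_of_withDensity_le hc₀ hK hδ hβ hA0 ρ hWm hW hρ hnK hSδ
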